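/- Let $n\in\mathbb N$, and let $(\ell,Q,\nu)$ be a Lévy triplet on $\mathbb R^n$: $\ell\in\mathbb R^n$, $Q\in\mathbb R^{n\times n}$ is (symmetric) positive semidefinite, and $\nu$ is a Borel measure on $\mathbb R^n\setminus\{0\}$ with $\int_{y\ne 0}\min\{1,|y|^2\}\,\nu(dy)<\infty$. Let $(A,\mathcal D(A))$ be the corresponding Lévy operator on the Banach space $C_\infty(\mathbb R^n)$ of real continuous functions vanishing at infinity (with the supremum norm), that is, the closure of the operator $$Au(x)=\ell\cdot\nabla u(x)+\tfrac12\operatorname{div}(Q\nabla u(x))+\int_{y\neq0}\bigl(u(x+y)-u(x)-y\cdot\nabla u(x)\mathbf 1_{(0,1)}(|y|)\bigr)\,\nu(dy),\qquad u\in C_c^\infty(\mathbb R^n).$$ Let $(X_t)_{t\ge0}$ be the associated Lévy process, i.e. an $\mathbb R^n$-valued process on a probability space with $X_0=0$ a.s., stationary and independent increments, a.s. right-continuous trajectories, and $\mathbb E\,e^{i\xi\cdot X_t}=e^{-t\psi(\xi)}$, where $$\psi(\xi)=-i\ell\cdot\xi+\tfrac12\,\xi\cdot Q\xi+\int_{y\ne0}\bigl(1-e^{i\xi\cdot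 y}+i\,\xi\cdot y\,\mathbf 1_{(0,1)}(|y|)\bigr)\,\nu(dy).$$ The operator $A$ is said to satisfy the unique continuation principle (UCP) if, for every $u\in\mathcal D(A)$ and every non-empty open set $G\subset\mathbb R^n$, $Au|_G=0$ and $u|_G=0$ imply $u=0$ on $\mathbb R^n$. For $\epsilon>0$ write $B_\epsilon(0)$ and $\overline{B_\epsilon(0)}$ for the open and the closed ball, and for a finite Borel measure $\mu$ on $\mathbb R^n$ put $$\Sigma(\mu,\epsilon):=\bigl\{\mu(\cdot+x)|_{\mathbb R^n\setminus\overline{B_\epsilon(0)}} : x\in B_\epsilon(0)\bigr\},$$ where $\mu(\cdot+x)$ denotes the measure $B\mapsto\mu(B+x)$. Then $A$ satisfies the UCP if, and only if, for every exponentially distributed random time $\tau$ (with arbitrary parameter $\lambda>0$) which is independent of $(X_t)_{t\ge0}$, possibly defined on an extension of the underlying probability space, and for every $\epsilon>0$, the linear span of $\Sigma(\mathrm{Law}(X_\tau),\epsilon)$ is vaguely dense in the space of finite signed Borel measures on $\mathbb R^n\setminus\overline{B_\epsilon(0)}$, i.e. dense for the topology induced by the functionals $m\mapsto\int\phi\,dm$,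 $\phi\in C_\infty(\mathbb R^n\setminus\overline{B_\epsilon(0)})$. -/

import Mathlib

open MeasureTheory ProbabilityTheory Filter Topology
open scoped NNReal ENNReal ZeroAtInfty

universe u

namespace LevyUCP

/-- Euclidean space `ℝⁿ`. -/
abbrev E (n : ℕ) : Type := EuclideanSpace ℝ (Fin n)

/-- A Lévy triplet `(ℓ, Q, ν)` on `ℝⁿ`: a drift vector, a (symmetric) positive semidefinite matrix,
and a Lévy measure, that is, a Borel measure on `ℝⁿ ∖ {0}` (regarded as a measure on `ℝⁿ` which
does not charge `0`) that integrates `min {1, |y|²}`. -/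
structure LevyTriplet (n : ℕ) where
  drift : E n
  Q : Matrix (Fin n) (Fin n) ℝ
  Q_posSemidef : Q.PosSemidef
  ν : Measure (E n)
  ν_zero : ν {0} = 0
  ν_lintegral : ∫⁻ y, ENNReal.ofReal (min 1 (‖y‖ ^ 2)) ∂ν < ∞

variable {n : ℕ}

/-- The partial derivative `∂ᵢ u`. -/
noncomputable def partialDeriv (i : Fin n) (u : E n → ℝ) (x : E n) : ℝ :=
  fderiv ℝ u x (EuclideanSpace.single i 1)

/-- The integro-differential expression
`ℓ·∇u(x) + ½ div(Q∇u)(x) + ∫ (u(x+y) - u(x) - y·∇u(x) 1_{|y|<1}) ν(dy)`. -/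
noncomputable def LevyTriplet.apply (T : LevyTriplet n) (u : E n → ℝ) (x : E n) : ℝ :=
  fderiv ℝ u x T.drift
    + (1 / 2 : ℝ) * ∑ i, partialDeriv i (fun z => ∑ j, T.Q i j * partialDeriv j u z) x
    + ∫ y, (u (x + y) - u x - if ‖y‖ < 1 then fderiv ℝ u x y else 0) ∂T.ν

/-- The graph of the operator on the test functions `C_c^∞(ℝⁿ)`, in the Banach space
`C_∞(ℝⁿ) × C_∞(ℝⁿ)`, where `C_∞` carries the supremum norm. -/
def LevyTriplet.testGraph (T : LevyTriplet n) : Set (C₀(E n, ℝ) × C₀(E n, ℝ)) :=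
  {p | ContDiff ℝ ((⊤ : ℕ∞) : WithTop ℕ∞) p.1 ∧ HasCompactSupport p.1 ∧ ∀ x, p.2 x = T.apply p.1 x}

/-- The graph of the Lévy operator `(A, 𝒟(A))` on `C_∞(ℝⁿ)`, the closure of the operator on
`C_c^∞(ℝⁿ)`: `(u, f)` belongs to it iff `u ∈ 𝒟(A)` and `A u = f`. -/
def LevyTriplet.graph (T : LevyTriplet n) : Set (C₀(E n, ℝ) × C₀(E n, ℝ)) :=
  closure T.testGraph

/-- The unique continuation principle for the Lévy operator `(A, 𝒟(A))`: if `u ∈ 𝒟(A)` is such that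
`u = 0` and `A u = 0` on some non-empty open set, then `u = 0`. -/
def LevyTriplet.UCP (T : LevyTriplet n) : Prop :=
  ∀ u f : C₀(E n, ℝ), (u, f) ∈ T.graph →
    (∃ G : Set (E n), IsOpen G ∧ G.Nonempty ∧ (∀ x ∈ G, f x = 0) ∧ (∀ x ∈ G, u x = 0)) →
    u = 0

/-- The characteristic exponent
`ψ(ξ) = -i ℓ·ξ + ½ ξ·Qξ + ∫ (1 - e^{i ξ·y} + i ξ·y 1_{|y|<1}) ν(dy)`. -/
noncomputable def LevyTriplet.exponent (T : LevyTriplet n) (ξ : E n) : ℂ :=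
  -Complex.I * (inner ℝ T.drift ξ : ℝ)
    + (((1 / 2 : ℝ) * ∑ i, ∑ j, ξ i * T.Q i j * ξ j : ℝ) : ℂ)
    + ∫ y, (1 - Complex.exp (Complex.I * (inner ℝ y ξ : ℝ))
        + if ‖y‖ < 1 then Complex.I * (inner ℝ y ξ : ℝ) else 0) ∂T.ν


section Random

variable {Ω : Type*} [MeasurableSpace Ω]

/-- `X` is a Lévy process with values in `ℝⁿ`: it starts at `0`, has independent and stationary
increments and right-continuous trajectories. -/
structure IsLevy (X : ℝ≥0 → Ω → E n) (P : Measure Ω) : Prop where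
  measurable : ∀ t, Measurable (X t)
  start_zero : ∀ᵐ ω ∂P, X 0 ω = 0
  indep_increments : HasIndepIncrements X P
  stationary_increments : ∀ s t : ℝ≥0, IdentDistrib (fun ω => X (s + t) ω - X s ω) (X t) P P
  right_continuous : ∀ᵐ ω ∂P, ∀ t, ContinuousWithinAt (fun s => X s ω) (Set.Ici t) t

/-- `X` is the Lévy process associated with the Lévy operator of triplet `T`: it is a Lévy process
with `𝔼 e^{i ξ·X_t} = e^{-t ψ(ξ)}`. -/
structure LevyTriplet.IsAssociated (T : LevyTriplet n) (X : ℝ≥0 → Ω → E n)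
    (P : Measure Ω) : Prop where
  isLevy : IsLevy X P
  charFun_eq : ∀ (t : ℝ≥0) (ξ : E n),
    charFun (P.map (X t)) ξ = Complex.exp (-(((t : ℝ) : ℂ) * T.exponent ξ))

end Random

/-- The vague topology on the finite signed Borel measures on `Y`: the weak topology induced by
the functionals `m ↦ ∫ φ dm`, `φ ∈ C_∞(Y)`. -/
@[reducible] noncomputable def vagueTopology (Y : Type*) [TopologicalSpace Y] [MeasurableSpace Y] :
    TopologicalSpace (SignedMeasure Y) :=
  ⨅ φ : C₀(Y, ℝ), TopologicalSpace.induced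
    (fun m : SignedMeasure Y => m.integral φ (ContinuousLinearMap.lsmul ℝ ℝ)) inferInstance

/-- Density with respect to the vague topology. -/
def VaguelyDense {Y : Type*} [TopologicalSpace Y] [MeasurableSpace Y]
    (S : Set (SignedMeasure Y)) : Prop :=
  @Dense _ (vagueTopology Y) S

/-- The complement `ℝⁿ ∖ B̄_ε(0)` of the closed ball, as an (open) subspace. -/
abbrev Exterior (n : ℕ) (ε : ℝ) : Type := ↥((Metric.closedBall (0 : E n) ε)ᶜ)

/-- The shifted and restricted measure `μ(· + x)|_{ℝⁿ ∖ B̄_ε(0)}`, `B ↦ μ(B + x)`. -/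
noncomputable def shiftRestrict (μ : Measure (E n)) [IsFiniteMeasure μ] (ε : ℝ) (x : E n) :
    SignedMeasure (Exterior n ε) :=
  ((μ.map (fun y => y - x)).comap (Subtype.val : Exterior n ε → E n)).toSignedMeasure

/-- The family `Σ(μ, ε) = {μ(· + x)|_{ℝⁿ ∖ B̄_ε(0)} | x ∈ B_ε(0)}`. -/
def shiftFamily (μ : Measure (E n)) [IsFiniteMeasure μ] (ε : ℝ) :
    Set (SignedMeasure (Exterior n ε)) :=
  {m | ∃ x ∈ Metric.ball (0 : E n) ε, m = shiftRestrict μ ε x}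

end LevyUCP

namespace LevyUCP

open scoped FourierTransform ContDiff RealInnerProductSpace

variable {n : ℕ}

/-! ### The Lévy measure and the Lévy–Khintchine kernel. -/

section LevyMeasure

/-! Let `ρ` be the law of `X_τ`. The resolvent `r (r - A)⁻¹` is the operator `R g (x) = ∫ g (x + y)
ρ(dy)`, so elements of the domain are the functions `u = R g`, with `A u = r (R g - g)`. Hence `u`
and `A u` vanish on an open set iff `R g` and `g` do, and by translation the set may be taken to be
a ball about `0`. Functions `g` of class `C₀` that vanish on the closed ball are exactly the
functions of class `C₀` on the exterior, and `R g (-x)` is the pairing of `g` with the shifted,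
restricted measure. So UCP says that only `0` annihilates the shift family, which by duality is
vague density of its span (`vaguelyDense_span_iff`).

The resolvent facts are proved without semigroup theory. On test functions `A` has Fourier symbol
`-ψ` (`LevyTriplet.apply_eq_fourierInv`), and `ρ` has characteristic function `r / (r + ψ)`
(`isPotential_at_time`); the factors cancel and the identity passes to the closure
(`average_of_mem_graph`). Averages of translates stay in the closed graph by convexity, so `R` maps
into the domain (`average_mem_graph_of_isPotential`). Injectivity of `R` comes down to
single-valuedness of the closure (`eq_zero_of_zero_mem_graph`). -/

lemma LevyTriplet.integrable_min (T : LevyTriplet n) :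
    Integrable (fun y => min 1 (‖y‖ ^ 2)) T.ν := by
  refine ⟨by fun_prop, ?_⟩
  rw [hasFiniteIntegral_iff_ofReal (.of_forall fun y => by positivity)]
  exact T.ν_lintegral

/-- Weighting by `min 1 |y|²` makes `ν` finite, and the weight can be divided out again because it
vanishes only at `0`, which `ν` does not charge. This is what Fubini needs. -/
lemma LevyTriplet.sfinite (T : LevyTriplet n) : SFinite T.ν := by
  set f : E n → ℝ≥0∞ := fun y => ENNReal.ofReal (min 1 (‖y‖ ^ 2)) with hf
  have hfm : Measurable f := by fun_prop
  have hfin : IsFiniteMeasure (T.ν.withDensity f) :=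
    isFiniteMeasure_withDensity T.ν_lintegral.ne
  have h0 : ∀ᵐ y ∂T.ν, f y ≠ 0 := by
    have : ∀ᵐ y ∂T.ν, y ≠ 0 := by
      rw [ae_iff]; simpa using T.ν_zero
    filter_upwards [this] with y hy
    simp only [hf, ne_eq, ENNReal.ofReal_eq_zero, not_le]
    positivity
  rw [← withDensity_inv_same₀ hfm.aemeasurable h0 (.of_forall fun y => ENNReal.ofReal_ne_top)]
  infer_instance

/-- The Lévy–Khintchine integrand `e^{i ξ·y} - 1 - i ξ·y 1_{|y|<1}`. -/
noncomputable def levyKernel (ξ y : E n) : ℂ :=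
  Complex.exp (Complex.I * (⟪y, ξ⟫ : ℝ)) - 1 - if ‖y‖ < 1 then Complex.I * (⟪y, ξ⟫ : ℝ) else 0

lemma norm_exp_I_mul_sub_one_sub_le (a : ℝ) :
    ‖Complex.exp (Complex.I * a) - 1 - Complex.I * a‖ ≤ 3 * a ^ 2 := by
  have hn : ‖Complex.I * (a : ℂ)‖ = |a| := by simp
  rcases le_total |a| 1 with h | h
  · have := Complex.norm_exp_sub_one_sub_id_le (x := Complex.I * a) (by rwa [hn])
    rw [hn, sq_abs] at this
    nlinarith [sq_nonneg a]
  · have h1 := Real.norm_exp_I_mul_ofReal_sub_one_le (x := a)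
    have h2 := norm_sub_le (Complex.exp (Complex.I * a) - 1) (Complex.I * a)
    rw [hn] at h2
    rw [Real.norm_eq_abs] at h1
    nlinarith [sq_abs a]

/-- Second-order Taylor bound for small jumps, boundedness for large ones. The majorant is a product
of a function of `ξ` and a function of `y`, so against a Schwartz function it is integrable in both
variables jointly. -/
lemma norm_levyKernel_le (ξ y : E n) :
    ‖levyKernel ξ y‖ ≤ 3 * (1 + ‖ξ‖ ^ 2) * min 1 (‖y‖ ^ 2) := by
  unfold levyKernel
  split_ifs with h
  · have hy : ‖y‖ ^ 2 ≤ 1 := by nlinarith [norm_nonneg y]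
    rw [min_eq_right hy]
    refine (norm_exp_I_mul_sub_one_sub_le _).trans ?_
    have h1 : (⟪y, ξ⟫ : ℝ) ^ 2 ≤ (‖y‖ * ‖ξ‖) ^ 2 := by
      rw [← sq_abs]
      gcongr
      exact abs_real_inner_le_norm y ξ
    nlinarith [sq_nonneg ‖y‖]
  · have hy : 1 ≤ ‖y‖ ^ 2 := by nlinarith
    rw [min_eq_left hy, sub_zero]
    have h1 : ‖Complex.exp (Complex.I * (⟪y, ξ⟫ : ℝ))‖ = 1 := by
      rw [mul_comm]; exact Complex.norm_exp_ofReal_mul_I _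
    have h2 := norm_sub_le (Complex.exp (Complex.I * (⟪y, ξ⟫ : ℝ))) 1
    rw [h1, norm_one] at h2
    nlinarith [sq_nonneg ‖ξ‖]

lemma measurable_levyKernel : Measurable (Function.uncurry (levyKernel (n := n))) := by
  unfold levyKernel Function.uncurry
  refine Measurable.sub (by fun_prop) (Measurable.ite ?_ (by fun_prop) (by fun_prop))
  exact measurableSet_lt (by fun_prop) (by fun_prop)

lemma LevyTriplet.exponent_eq (T : LevyTriplet n) (ξ : E n) :
    -T.exponent ξ = Complex.I * (⟪T.drift, ξ⟫ : ℝ)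
      - (((1 / 2 : ℝ) * ∑ i, ∑ j, ξ i * T.Q i j * ξ j : ℝ) : ℂ)
      + ∫ y, levyKernel ξ y ∂T.ν := by
  have : ∫ y, (1 - Complex.exp (Complex.I * (⟪y, ξ⟫ : ℝ))
        + if ‖y‖ < 1 then Complex.I * (⟪y, ξ⟫ : ℝ) else 0) ∂T.ν
      = -∫ y, levyKernel ξ y ∂T.ν := by
    rw [← integral_neg]
    congr 1 with y
    unfold levyKernel
    ring
  unfold LevyTriplet.exponent
  rw [this]
  ring

end LevyMeasure

/-! ### The Lévy operator as a Fourier multiplier. -/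

section Symbol

/-- The complexification of a real test function, as a Schwartz function. -/
noncomputable def complexTest {u : E n → ℝ} (hu : ContDiff ℝ ∞ u) (hc : HasCompactSupport u) :
    SchwartzMap (E n) ℂ :=
  (hc.comp_left (g := ((↑) : ℝ → ℂ)) Complex.ofReal_zero).toSchwartzMap
    (Complex.ofRealCLM.contDiff.comp hu)

@[simp] lemma complexTest_apply {u : E n → ℝ} (hu : ContDiff ℝ ∞ u) (hc : HasCompactSupport u)
    (x : E n) : complexTest hu hc x = u x := rfl

variable {u : E n → ℝ}

lemma contDiff_fderiv_apply (hu : ContDiff ℝ ∞ u) (m : E n) :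
    ContDiff ℝ ∞ (fun x => fderiv ℝ u x m) :=
  (hu.fderiv_right le_rfl).clm_apply contDiff_const

lemma hasCompactSupport_fderiv_apply (hc : HasCompactSupport u) (m : E n) :
    HasCompactSupport (fun x => fderiv ℝ u x m) :=
  hc.fderiv_apply ℝ m

open LineDeriv in
lemma complexTest_fderiv (hu : ContDiff ℝ ∞ u) (hc : HasCompactSupport u) (m : E n) :
    complexTest (contDiff_fderiv_apply hu m) (hasCompactSupport_fderiv_apply hc m) =
      ∂_{m} (complexTest hu hc) := by
  ext x
  rw [complexTest_apply, SchwartzMap.lineDerivOp_apply_eq_fderiv]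
  have h1 : HasFDerivAt (complexTest hu hc) (Complex.ofRealCLM ∘L fderiv ℝ u x) x :=
    Complex.ofRealCLM.hasFDerivAt.comp x
      ((hu.differentiable (by simp)) x).hasFDerivAt
  rw [h1.fderiv]
  simp

lemma fourier_complexTest_fderiv (hu : ContDiff ℝ ∞ u) (hc : HasCompactSupport u) (m w : E n) :
    𝓕 (complexTest (contDiff_fderiv_apply hu m) (hasCompactSupport_fderiv_apply hc m)) w =
      2 * Real.pi * Complex.I * (⟪w, m⟫ : ℝ) * 𝓕 (complexTest hu hc) w := by
  rw [complexTest_fderiv hu hc, SchwartzMap.fourier_lineDerivOp_eq]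
  have : Function.HasTemperateGrowth (fun w : E n => (⟪w, m⟫ : ℝ)) :=
    ((innerSL ℝ).flip m).hasTemperateGrowth
  simp [this, mul_assoc]

lemma eq_fourierInv (hu : ContDiff ℝ ∞ u) (hc : HasCompactSupport u) (x : E n) :
    (u x : ℂ) = ∫ w, Real.fourierChar ⟪w, x⟫ • 𝓕 (complexTest hu hc) w := by
  have : 𝓕⁻ (𝓕 (complexTest hu hc)) = complexTest hu hc := FourierPair.fourierInv_fourier_eq _
  rw [← complexTest_apply hu hc, ← Real.fourierInv_eq, ← SchwartzMap.fourierInv_coe, this]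

lemma fderiv_eq_fourierInv (hu : ContDiff ℝ ∞ u) (hc : HasCompactSupport u) (m x : E n) :
    (fderiv ℝ u x m : ℂ) = ∫ w, Real.fourierChar ⟪w, x⟫ •
      (2 * Real.pi * Complex.I * (⟪w, m⟫ : ℝ) * 𝓕 (complexTest hu hc) w) := by
  rw [eq_fourierInv (contDiff_fderiv_apply hu m) (hasCompactSupport_fderiv_apply hc m)]
  congr 1 with w
  rw [fourier_complexTest_fderiv hu hc]

lemma fderiv_fderiv_eq_fourierInv (hu : ContDiff ℝ ∞ u) (hc : HasCompactSupport u)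
    (m k x : E n) :
    (fderiv ℝ (fun z => fderiv ℝ u z m) x k : ℂ) = ∫ w, Real.fourierChar ⟪w, x⟫ •
      (-(4 * Real.pi ^ 2) * (⟪w, k⟫ : ℝ) * (⟪w, m⟫ : ℝ) * 𝓕 (complexTest hu hc) w) := by
  rw [fderiv_eq_fourierInv (contDiff_fderiv_apply hu m) (hasCompactSupport_fderiv_apply hc m)]
  congr 1 with w
  rw [fourier_complexTest_fderiv hu hc]
  congr 1
  linear_combination (4 * Real.pi ^ 2 * (⟪w, k⟫ : ℝ) * (⟪w, m⟫ : ℝ) *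
    𝓕 (complexTest hu hc) w) * Complex.I_sq

lemma integrable_fourierChar_smul_iff {x : E n} {f : E n → ℂ} :
    Integrable (fun w => Real.fourierChar ⟪w, x⟫ • f w) ↔ Integrable f := by
  have := Real.fourierIntegral_convergent_iff (μ := volume) (f := f) (-x)
  simpa using this

lemma integrable_one_add_sq_mul (f : SchwartzMap (E n) ℂ) :
    Integrable (fun w => (1 + ‖w‖ ^ 2) * ‖f w‖) := by
  have h0 := f.integrable_pow_mul volume 0
  have h2 := f.integrable_pow_mul volume 2
  refine (h0.add h2).congr (.of_forall fun w => ?_)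
  simp; ring

lemma integrable_levyKernel_mul (T : LevyTriplet n) [SFinite T.ν] (f : SchwartzMap (E n) ℂ) :
    Integrable (fun p : E n × E n => levyKernel ((2 * Real.pi) • p.2) p.1 * f p.2)
      (T.ν.prod volume) := by
  have hb := T.integrable_min.mul_prod (integrable_one_add_sq_mul f)
  refine (hb.const_mul (3 * (1 + (2 * Real.pi) ^ 2))).mono' ?_ (.of_forall fun p => ?_)
  · have h1 : Measurable fun p : E n × E n => levyKernel ((2 * Real.pi) • p.2) p.1 :=
      measurable_levyKernel.comp (f := fun p : E n × E n => ((2 * Real.pi) • p.2, p.1))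
        (by fun_prop)
    exact (h1.mul (f.continuous.measurable.comp measurable_snd)).aestronglyMeasurable
  · rw [norm_mul]
    have h := norm_levyKernel_le ((2 * Real.pi) • p.2) p.1
    have h' : 1 + ‖(2 * Real.pi) • p.2‖ ^ 2 ≤ (1 + (2 * Real.pi) ^ 2) * (1 + ‖p.2‖ ^ 2) := by
      rw [norm_smul, Real.norm_of_nonneg (by positivity)]
      nlinarith [sq_nonneg ‖p.2‖, sq_nonneg (2 * Real.pi)]
    calc _ ≤ (3 * (1 + ‖(2 * Real.pi) • p.2‖ ^ 2) * min 1 (‖p.1‖ ^ 2)) * ‖f p.2‖ := by gcongr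
      _ ≤ (3 * ((1 + (2 * Real.pi) ^ 2) * (1 + ‖p.2‖ ^ 2)) * min 1 (‖p.1‖ ^ 2)) * ‖f p.2‖ := by
        gcongr
      _ = _ := by ring

lemma integrable_inner_mul (f : SchwartzMap (E n) ℂ) (m : E n) :
    Integrable (fun w => ((⟪w, m⟫ : ℝ) : ℂ) * f w) := by
  refine ((integrable_one_add_sq_mul f).const_mul ‖m‖).mono' ?_ (.of_forall fun w => ?_)
  · exact (Continuous.mul (by fun_prop) f.continuous).aestronglyMeasurable
  · rw [norm_mul, Complex.norm_real]
    have h1 := abs_real_inner_le_norm w m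
    rw [← Real.norm_eq_abs] at h1
    calc _ ≤ (‖w‖ * ‖m‖) * ‖f w‖ := by gcongr
      _ ≤ ((1 + ‖w‖ ^ 2) * ‖m‖) * ‖f w‖ := by gcongr; nlinarith [sq_nonneg (‖w‖ - 1)]
      _ = _ := by ring

lemma integrable_inner_mul_inner_mul (f : SchwartzMap (E n) ℂ) (m k : E n) :
    Integrable (fun w => ((⟪w, k⟫ : ℝ) : ℂ) * (⟪w, m⟫ : ℝ) * f w) := by
  refine ((integrable_one_add_sq_mul f).const_mul (‖m‖ * ‖k‖)).mono' ?_ (.of_forall fun w => ?_)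
  · exact (Continuous.mul (by fun_prop) f.continuous).aestronglyMeasurable
  · rw [norm_mul, norm_mul, Complex.norm_real, Complex.norm_real]
    have h1 := abs_real_inner_le_norm w m
    have h2 := abs_real_inner_le_norm w k
    rw [← Real.norm_eq_abs] at h1 h2
    calc _ ≤ (‖w‖ * ‖k‖) * (‖w‖ * ‖m‖) * ‖f w‖ := by gcongr
      _ = (‖w‖ ^ 2 * (‖m‖ * ‖k‖)) * ‖f w‖ := by ring
      _ ≤ ((1 + ‖w‖ ^ 2) * (‖m‖ * ‖k‖)) * ‖f w‖ := by gcongr; linarith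
      _ = _ := by ring

lemma fourierChar_eq_exp (a : ℝ) :
    ((Real.fourierChar a : Circle) : ℂ) = Complex.exp (Complex.I * (2 * Real.pi * a : ℝ)) := by
  rw [Real.fourierChar_apply, mul_comm]

/-- The jump part of the operator is the Fourier multiplier of the jump part of the exponent. -/
lemma integral_jump_eq (T : LevyTriplet n) (hu : ContDiff ℝ ∞ u) (hc : HasCompactSupport u)
    (x : E n) :
    ((∫ y, (u (x + y) - u x - if ‖y‖ < 1 then fderiv ℝ u x y else 0) ∂T.ν : ℝ) : ℂ) =
      ∫ w, Real.fourierChar ⟪w, x⟫ •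
        ((∫ y, levyKernel ((2 * Real.pi) • w) y ∂T.ν) * 𝓕 (complexTest hu hc) w) := by
  have := T.sfinite
  set h := 𝓕 (complexTest hu hc) with hh
  have hint : ∀ z, Integrable (fun w => Real.fourierChar ⟪w, z⟫ • h w) := fun z =>
    integrable_fourierChar_smul_iff.2 h.integrable
  -- For a fixed jump `y`, the compensated difference of `u` is itself a Fourier multiplier, with
  -- symbol the kernel at `2πw`.
  have key : ∀ y : E n,
      ((u (x + y) - u x - if ‖y‖ < 1 then fderiv ℝ u x y else 0 : ℝ) : ℂ) =
        ∫ w, Real.fourierChar ⟪w, x⟫ • (levyKernel ((2 * Real.pi) • w) y * h w) := by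
    intro y
    have e1 : ((u (x + y) - u x : ℝ) : ℂ) = ∫ w, (Real.fourierChar ⟪w, x + y⟫ • h w -
        Real.fourierChar ⟪w, x⟫ • h w) := by
      rw [integral_sub (hint _) (hint _), ← eq_fourierInv, ← eq_fourierInv]
      push_cast; rfl
    have hi1 : Integrable (fun w => (Real.fourierChar ⟪w, x + y⟫ • h w -
        Real.fourierChar ⟪w, x⟫ • h w)) := (hint _).sub (hint _)
    have hi2 : Integrable (fun w => Real.fourierChar ⟪w, x⟫ •
        (2 * Real.pi * Complex.I * (⟪w, y⟫ : ℝ) * h w)) := by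
      refine integrable_fourierChar_smul_iff.2 ?_
      simpa only [mul_assoc] using ((integrable_inner_mul h y).const_mul (2 * Real.pi * Complex.I))
    have e2 : ∀ w, (Real.fourierChar ⟪w, x + y⟫ • h w - Real.fourierChar ⟪w, x⟫ • h w) =
        Real.fourierChar ⟪w, x⟫ •
          ((Complex.exp (Complex.I * (⟪y, (2 * Real.pi) • w⟫ : ℝ)) - 1) * h w) := by
      intro w
      simp only [Circle.smul_def, smul_eq_mul, inner_add_right, AddChar.map_add_eq_mul,
        Circle.coe_mul, fourierChar_eq_exp, inner_smul_right, real_inner_comm y w]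
      ring
    unfold levyKernel
    split_ifs with hy
    · rw [Complex.ofReal_sub, e1, fderiv_eq_fourierInv hu hc, ← integral_sub hi1 hi2]
      congr 1 with w
      rw [e2, ← smul_sub]
      congr 1
      rw [inner_smul_right, real_inner_comm y w]
      push_cast
      ring
    · rw [sub_zero, e1]
      congr 1 with w
      rw [e2, sub_zero]
  rw [← integral_complex_ofReal]
  simp_rw [key]
  rw [integral_integral_swap]
  · congr 1 with w
    simp_rw [Circle.smul_def, smul_eq_mul, integral_const_mul, integral_mul_const]
  · have := integrable_levyKernel_mul T h
    refine (this.norm).mono' ?_ (.of_forall fun p => ?_)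
    · have hm : Measurable fun p : E n × E n => ((Real.fourierChar ⟪p.2, x⟫ : Circle) : ℂ) := by
        simp_rw [fourierChar_eq_exp]
        fun_prop
      exact hm.aestronglyMeasurable.mul this.aestronglyMeasurable
    · simp [Function.uncurry]

/-- The inner sum is the directional derivative along the `i`-th row of `Q`, so the divergence term
becomes iterated directional derivatives. -/
lemma partialDeriv_sum_eq (T : LevyTriplet n) (u : E n → ℝ) (i : Fin n) (x : E n) :
    partialDeriv i (fun z => ∑ j, T.Q i j * partialDeriv j u z) x =
      fderiv ℝ (fun z => fderiv ℝ u z (WithLp.toLp 2 (T.Q i))) x (EuclideanSpace.single i 1) := by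
  unfold partialDeriv
  congr 2 with z
  have : (WithLp.toLp 2 (T.Q i) : E n) = ∑ j, T.Q i j • EuclideanSpace.single j (1 : ℝ) := by
    ext k
    simp [Finset.sum_apply, Pi.single_apply]
  rw [this, map_sum]
  simp

/-- The local part of the exponent, as a multiple of the Fourier variable. -/
noncomputable def LevyTriplet.localSymbol (T : LevyTriplet n) (w : E n) : ℂ :=
  2 * Real.pi * Complex.I * (⟪w, T.drift⟫ : ℝ) + (1 / 2) * ∑ i, -(4 * Real.pi ^ 2) *
    (((⟪w, EuclideanSpace.single i 1⟫ : ℝ) : ℂ) * ((⟪w, WithLp.toLp 2 (T.Q i)⟫ : ℝ) : ℂ))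

/-- The factor `2π` converts between the Fourier kernel `e^{-2πi w·x}` and the
characteristic-function convention `e^{i ξ·x}`. -/
lemma LevyTriplet.exponent_two_pi_smul (T : LevyTriplet n) (w : E n) :
    -T.exponent ((2 * Real.pi) • w) =
      T.localSymbol w + ∫ y, levyKernel ((2 * Real.pi) • w) y ∂T.ν := by
  rw [T.exponent_eq]
  congr 1
  unfold LevyTriplet.localSymbol
  have h : ∀ i, (⟪w, WithLp.toLp 2 (T.Q i)⟫ : ℝ) = ∑ j, T.Q i j * w j := fun i => by
    simp [PiLp.inner_apply]
  simp only [h, inner_smul_right, real_inner_comm]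
  simp only [PiLp.smul_apply, smul_eq_mul, EuclideanSpace.inner_single_right,
    one_mul, conj_trivial]
  push_cast
  simp only [Finset.mul_sum, sub_eq_add_neg, ← Finset.sum_neg_distrib]
  congr 1
  · ring
  · refine Finset.sum_congr rfl fun i _ => ?_
    refine Finset.sum_congr rfl fun j _ => ?_
    ring

lemma integrable_localSymbol_mul (T : LevyTriplet n) (f : SchwartzMap (E n) ℂ) :
    Integrable (fun w => T.localSymbol w * f w) := by
  have h1 := (integrable_inner_mul f T.drift).const_mul (2 * Real.pi * Complex.I)
  have h2 : Integrable (fun w => ∑ i, -(4 * Real.pi ^ 2 : ℂ) *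
      ((⟪w, EuclideanSpace.single i 1⟫ : ℝ) * (⟪w, WithLp.toLp 2 (T.Q i)⟫ : ℝ) * f w)) :=
    integrable_finsetSum _ fun i _ => (integrable_inner_mul_inner_mul f
      (WithLp.toLp 2 (T.Q i)) (EuclideanSpace.single i 1)).const_mul _
  refine (h1.add (h2.const_mul (1 / 2))).congr (.of_forall fun w => ?_)
  simp only [Pi.add_apply, LevyTriplet.localSymbol, add_mul, mul_assoc, Finset.sum_mul]

lemma integrable_exponent_mul (T : LevyTriplet n) (f : SchwartzMap (E n) ℂ) :
    Integrable (fun w => T.exponent ((2 * Real.pi) • w) * f w) := by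
  have := T.sfinite
  have h2 := (integrable_levyKernel_mul T f).integral_prod_right
  simp only [integral_mul_const] at h2
  refine ((integrable_localSymbol_mul T f).add h2).neg.congr (.of_forall fun w => ?_)
  simp only [Pi.neg_apply, Pi.add_apply, ← add_mul, ← T.exponent_two_pi_smul]
  ring

lemma integral_local_eq (T : LevyTriplet n) (hu : ContDiff ℝ ∞ u) (hc : HasCompactSupport u)
    (x : E n) :
    ((fderiv ℝ u x T.drift + (1 / 2 : ℝ) * ∑ i,
        partialDeriv i (fun z => ∑ j, T.Q i j * partialDeriv j u z) x : ℝ) : ℂ) =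
      ∫ w, Real.fourierChar ⟪w, x⟫ • (T.localSymbol w * 𝓕 (complexTest hu hc) w) := by
  set h := 𝓕 (complexTest hu hc) with hh
  simp only [partialDeriv_sum_eq T u]
  push_cast
  rw [fderiv_eq_fourierInv hu hc]
  simp only [fderiv_fderiv_eq_fourierInv hu hc, ← hh]
  have i1 : Integrable (fun w => Real.fourierChar ⟪w, x⟫ •
      (2 * Real.pi * Complex.I * (⟪w, T.drift⟫ : ℝ) * h w)) := by
    refine integrable_fourierChar_smul_iff.2 ?_
    simpa only [mul_assoc] using
      ((integrable_inner_mul h T.drift).const_mul (2 * Real.pi * Complex.I))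
  have i2 : ∀ i ∈ Finset.univ, Integrable (fun w => Real.fourierChar ⟪w, x⟫ •
      (-(4 * Real.pi ^ 2) * (⟪w, EuclideanSpace.single i 1⟫ : ℝ) *
        (⟪w, WithLp.toLp 2 (T.Q i)⟫ : ℝ) * h w)) := by
    refine fun i _ => integrable_fourierChar_smul_iff.2 ?_
    simpa only [mul_assoc] using ((integrable_inner_mul_inner_mul h (WithLp.toLp 2 (T.Q i))
      (EuclideanSpace.single i 1)).const_mul (-(4 * Real.pi ^ 2 : ℂ)))
  rw [← integral_finsetSum _ i2, ← integral_const_mul,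
    ← integral_add i1 ((integrable_finsetSum _ i2).const_mul _)]
  congr 1 with w
  simp only [LevyTriplet.localSymbol, Circle.smul_def, smul_eq_mul, Finset.mul_sum, add_mul,
    mul_add, Finset.sum_mul]
  congr 1
  exact Finset.sum_congr rfl fun i _ => by ring

/-- On test functions the Lévy operator is the pseudo-differential operator with symbol `-ψ`. -/
theorem LevyTriplet.apply_eq_fourierInv (T : LevyTriplet n) (hu : ContDiff ℝ ∞ u)
    (hc : HasCompactSupport u) (x : E n) :
    (T.apply u x : ℂ) = ∫ w, Real.fourierChar ⟪w, x⟫ •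
      (-T.exponent ((2 * Real.pi) • w) * 𝓕 (complexTest hu hc) w) := by
  have := T.sfinite
  set h := 𝓕 (complexTest hu hc) with hh
  have h2 := (integrable_levyKernel_mul T h).integral_prod_right
  simp only [integral_mul_const] at h2
  rw [LevyTriplet.apply, Complex.ofReal_add, integral_local_eq T hu hc, integral_jump_eq T hu hc,
    ← hh, ← integral_add (integrable_fourierChar_smul_iff.2 (integrable_localSymbol_mul T h))
      (integrable_fourierChar_smul_iff.2 h2)]
  congr 1 with w
  rw [T.exponent_two_pi_smul, add_mul, smul_add]

/-- The inverse Fourier transform of an integrable function belongs to `C₀`. -/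
lemma exists_zeroAtInfty_of_fourierInv {f : E n → ℂ} (hf : Integrable f) {v : E n → ℝ}
    (hv : ∀ x, (v x : ℂ) = ∫ w, Real.fourierChar ⟪w, x⟫ • f w) :
    ∃ g : C₀(E n, ℝ), ∀ x, g x = v x := by
  have hv' : ∀ x, v x = (𝓕 f (-x)).re := fun x => by
    rw [← Real.fourierInv_eq_fourier_neg, Real.fourierInv_eq, ← hv, Complex.ofReal_re]
  have hcont : Continuous (𝓕 f) := VectorFourier.fourierIntegral_continuous
    Real.continuous_fourierChar continuous_inner hf
  have hlim : Tendsto (𝓕 f) (cocompact (E n)) (𝓝 0) := tendsto_integral_exp_inner_smul_cocompact f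
  refine ⟨⟨⟨v, ?_⟩, ?_⟩, fun x => rfl⟩
  · rw [funext hv']
    exact Complex.continuous_re.comp (hcont.comp continuous_neg)
  · change Tendsto v _ _
    rw [funext hv']
    have h1 : Tendsto (fun x : E n => -x) (cocompact (E n)) (cocompact (E n)) :=
      (Homeomorph.neg (E n)).isClosedEmbedding.tendsto_cocompact
    exact (Complex.continuous_re.tendsto' 0 0 rfl).comp (hlim.comp h1)

/-- Riemann–Lebesgue, since `ψ` times the transform of `u` is integrable. Consequently `testGraph`
contains a pair over every test function. -/
lemma LevyTriplet.exists_apply_eq (T : LevyTriplet n) (hu : ContDiff ℝ ∞ u)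
    (hc : HasCompactSupport u) : ∃ g : C₀(E n, ℝ), ∀ x, g x = T.apply u x := by
  refine exists_zeroAtInfty_of_fourierInv ?_ (T.apply_eq_fourierInv hu hc)
  simp only [neg_mul]
  exact (integrable_exponent_mul T (𝓕 (complexTest hu hc))).neg

end Symbol

end LevyUCP

namespace LevyUCP

open scoped FourierTransform ContDiff RealInnerProductSpace

variable {n : ℕ}

/-! ### Functions vanishing at infinity and their approximation. -/

section ZeroAtInfty

variable {Y : Type*} [TopologicalSpace Y]

lemma zeroAtInfty_norm_le {g : C₀(Y, ℝ)} {C : ℝ} (hC : 0 ≤ C) :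
    ‖g‖ ≤ C ↔ ∀ x, |g x| ≤ C := by
  rw [← ZeroAtInftyContinuousMap.norm_toBCF_eq_norm, BoundedContinuousFunction.norm_le hC]
  rfl

lemma zeroAtInfty_abs_le_norm (g : C₀(Y, ℝ)) (x : Y) : |g x| ≤ ‖g‖ :=
  (zeroAtInfty_norm_le (norm_nonneg g)).1 le_rfl x

/-- Evaluation at a point, as a continuous linear functional on `C₀`. -/
noncomputable def evalCLM (x : Y) : C₀(Y, ℝ) →L[ℝ] ℝ :=
  LinearMap.mkContinuous
    { toFun := fun g => g x
      map_add' := fun _ _ => rfl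
      map_smul' := fun _ _ => rfl } 1 fun g => by
    simpa using zeroAtInfty_abs_le_norm g x

@[simp] lemma evalCLM_apply (x : Y) (g : C₀(Y, ℝ)) : evalCLM x g = g x := rfl

lemma integrable_zeroAtInfty {F : Type*} [TopologicalSpace F] [MeasurableSpace F] [BorelSpace F]
    (g : C₀(F, ℝ)) (ρ : Measure F) [IsFiniteMeasure ρ] : Integrable g ρ :=
  .of_bound (g.continuous.measurable.aestronglyMeasurable) ‖g‖
    (.of_forall fun x => zeroAtInfty_abs_le_norm g x)

/-- The truncation `g ↦ g - max (-ε) (min ε g)` has compact support. -/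
lemma exists_hasCompactSupport_near [R1Space Y] (g : C₀(Y, ℝ)) {ε : ℝ} (hε : 0 < ε) :
    ∃ f : Y → ℝ, Continuous f ∧ HasCompactSupport f ∧ ∀ x, |f x - g x| ≤ ε := by
  refine ⟨fun x => g x - max (-ε) (min ε (g x)), by fun_prop, ?_, fun x => ?_⟩
  · have h := (Metric.tendsto_nhds.1 g.zero_at_infty' ε hε)
    obtain ⟨K, hK, hKs⟩ := mem_cocompact.1 h
    refine HasCompactSupport.intro hK fun x hx => ?_
    have := hKs hx
    simp only [Set.mem_ofPred_eq, dist_zero_right, Real.norm_eq_abs, abs_lt] at this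
    change -ε < g x ∧ g x < ε at this
    change g x - max (-ε) (min ε (g x)) = 0
    rw [min_eq_right this.2.le, max_eq_right this.1.le, sub_self]
  · simp only [sub_sub_cancel_left, abs_neg]
    exact abs_le.2 ⟨le_max_left _ _, max_le (by linarith) (min_le_left _ _)⟩

end ZeroAtInfty

/-- The test functions are dense in `C₀`. -/
lemma exists_test_near (g : C₀(E n, ℝ)) {ε : ℝ} (hε : 0 < ε) :
    ∃ v : C₀(E n, ℝ), ContDiff ℝ ∞ v ∧ HasCompactSupport v ∧ ‖v - g‖ ≤ ε := by
  obtain ⟨f, hf, hfc, hfg⟩ := exists_hasCompactSupport_near g (half_pos hε)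
  obtain ⟨v, hv, hvf, hvs⟩ := hf.exists_contDiff_approx ⊤ (ε := fun _ => ε / 2)
    continuous_const (fun _ => half_pos hε)
  have hvc : HasCompactSupport v := hfc.mono hvs
  refine ⟨⟨⟨v, hv.continuous⟩, hvc.is_zero_at_infty⟩, hv, hvc, ?_⟩
  refine (zeroAtInfty_norm_le hε.le).2 fun x => ?_
  have h1 := (hvf x).le
  rw [Real.dist_eq] at h1
  change |v x - g x| ≤ ε
  have h2 := abs_sub_le (v x) (f x) (g x)
  linarith [hfg x]

/-! ### Translates and their averages. -/

section Translate

/-- The translateC₀ `x ↦ g (x + y)`. -/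
noncomputable def translateC₀ (y : E n) (g : C₀(E n, ℝ)) : C₀(E n, ℝ) :=
  g.comp ⟨⟨fun x => x + y, by fun_prop⟩,
    (Homeomorph.addRight y).isClosedEmbedding.tendsto_cocompact⟩

@[simp] lemma translateC₀_apply (y : E n) (g : C₀(E n, ℝ)) (x : E n) :
    translateC₀ y g x = g (x + y) := rfl

/-- Uniform continuity of `g` gives norm continuity, so averages can be taken as Bochner integrals
in `C₀`. -/
lemma continuous_translateC₀ (g : C₀(E n, ℝ)) : Continuous fun y => translateC₀ y g := by
  refine Metric.continuous_iff.2 fun y ε hε => ?_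
  obtain ⟨δ, hδ, h⟩ := Metric.uniformContinuous_iff.1
    (ZeroAtInftyContinuousMap.uniformContinuous g) (ε / 2) (half_pos hε)
  refine ⟨δ, hδ, fun z hz => ?_⟩
  rw [dist_eq_norm]
  refine lt_of_le_of_lt ((zeroAtInfty_norm_le (half_pos hε).le).2 fun x => ?_) (half_lt_self hε)
  have := (h (a := x + z) (b := x + y) (by simpa using hz)).le
  rwa [Real.dist_eq] at this

lemma norm_translateC₀_le (y : E n) (g : C₀(E n, ℝ)) : ‖translateC₀ y g‖ ≤ ‖g‖ :=
  (zeroAtInfty_norm_le (norm_nonneg g)).2 fun x => zeroAtInfty_abs_le_norm g (x + y)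

variable (ρ : Measure (E n))

/-- The average `x ↦ ∫ g (x + y) ρ(dy)` of the translates of `g`. -/
noncomputable def average (g : C₀(E n, ℝ)) : C₀(E n, ℝ) := ∫ y, translateC₀ y g ∂ρ

lemma average_smul (c : ℝ) (g : C₀(E n, ℝ)) : average ρ (c • g) = c • average ρ g :=
  integral_smul c fun y => translateC₀ y g

variable [IsProbabilityMeasure ρ]

lemma integrable_translateC₀ (g : C₀(E n, ℝ)) : Integrable (fun y => translateC₀ y g) ρ :=
  .of_bound (continuous_translateC₀ g).aestronglyMeasurable ‖g‖
    (.of_forall fun y => norm_translateC₀_le y g)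

lemma average_apply (g : C₀(E n, ℝ)) (x : E n) : average ρ g x = ∫ y, g (x + y) ∂ρ := by
  rw [average, ← evalCLM_apply, ← ContinuousLinearMap.integral_comp_comm _
    (integrable_translateC₀ ρ g)]
  rfl

lemma norm_average_le (g : C₀(E n, ℝ)) : ‖average ρ g‖ ≤ ‖g‖ := by
  have := norm_integral_le_of_norm_le_const (μ := ρ) (f := fun y => translateC₀ y g) (C := ‖g‖)
    (.of_forall fun y => norm_translateC₀_le y g)
  simpa [average] using this

lemma average_add (g h : C₀(E n, ℝ)) : average ρ (g + h) = average ρ g + average ρ h :=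
  integral_add (integrable_translateC₀ ρ g) (integrable_translateC₀ ρ h)

/-- Averaging over translates, as a bounded operator on `C₀`. -/
noncomputable def averageCLM : C₀(E n, ℝ) →L[ℝ] C₀(E n, ℝ) :=
  LinearMap.mkContinuous
    { toFun := average ρ
      map_add' := average_add ρ
      map_smul' := average_smul ρ } 1 fun g => by simpa using norm_average_le ρ g

@[simp] lemma averageCLM_apply (g : C₀(E n, ℝ)) : averageCLM ρ g = average ρ g := rfl

end Translate

/-! ### Translation invariance and convexity of the graph. -/

section TestGraph

variable {T : LevyTriplet n}

lemma LevyTriplet.apply_translateC₀ (T : LevyTriplet n) (u : E n → ℝ) (y x : E n) :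
    T.apply (fun z => u (z + y)) x = T.apply u (x + y) := by
  have h : ∀ (w : E n → ℝ) (z : E n), fderiv ℝ (fun z => w (z + y)) z = fderiv ℝ w (z + y) :=
    fun w z => fderiv_comp_add_right y
  have hp : ∀ (i : Fin n) (w : E n → ℝ) (z : E n),
      partialDeriv i (fun z => w (z + y)) z = partialDeriv i w (z + y) := fun i w z => by
    unfold partialDeriv; rw [h]
  unfold LevyTriplet.apply
  simp only [h, hp]
  congr 1
  · congr 2
    refine Finset.sum_congr rfl fun i _ => ?_
    exact hp i (fun z => ∑ j, T.Q i j * partialDeriv j u z) x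
  · simp only [add_right_comm]

lemma translateC₀_mem_testGraph {u f : C₀(E n, ℝ)} (h : (u, f) ∈ T.testGraph) (y : E n) :
    (translateC₀ y u, translateC₀ y f) ∈ T.testGraph := by
  obtain ⟨h1, h2, h3⟩ := h
  refine ⟨h1.comp (contDiff_id.add contDiff_const), ?_, fun x => ?_⟩
  · exact h2.comp_homeomorph (Homeomorph.addRight y)
  · exact (h3 (x + y)).trans (T.apply_translateC₀ u y x).symm

/-- Linearity is read off from the Fourier representation, which avoids separate integrability
checks for the jump integrand. -/
lemma LevyTriplet.apply_linear (T : LevyTriplet n) {u v : E n → ℝ} (hu : ContDiff ℝ ∞ u)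
    (hv : ContDiff ℝ ∞ v) (hcu : HasCompactSupport u) (hcv : HasCompactSupport v) (a b : ℝ)
    (huv : ContDiff ℝ ∞ fun z => a * u z + b * v z)
    (hcuv : HasCompactSupport fun z => a * u z + b * v z) (x : E n) :
    T.apply (fun z => a * u z + b * v z) x = a * T.apply u x + b * T.apply v x := by
  have hs : complexTest huv hcuv = (a : ℂ) • complexTest hu hcu + (b : ℂ) • complexTest hv hcv := by
    ext z
    simp
  have hF : 𝓕 (complexTest huv hcuv) =
      (a : ℂ) • 𝓕 (complexTest hu hcu) + (b : ℂ) • 𝓕 (complexTest hv hcv) := by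
    rw [hs, FourierTransform.fourier_add, FourierTransform.fourier_smul,
      FourierTransform.fourier_smul]
  have hi : ∀ f : SchwartzMap (E n) ℂ, Integrable (fun w => Real.fourierChar ⟪w, x⟫ •
      (-T.exponent ((2 * Real.pi) • w) * f w)) := fun f => by
    refine integrable_fourierChar_smul_iff.2 ?_
    simp only [neg_mul]
    exact (integrable_exponent_mul T f).neg
  have key : ((T.apply (fun z => a * u z + b * v z) x : ℝ) : ℂ) =
      ((a * T.apply u x + b * T.apply v x : ℝ) : ℂ) := by
    push_cast
    rw [T.apply_eq_fourierInv huv hcuv, T.apply_eq_fourierInv hu hcu,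
      T.apply_eq_fourierInv hv hcv, ← integral_const_mul, ← integral_const_mul,
      ← integral_add ((hi _).const_mul _) ((hi _).const_mul _), hF]
    congr 1 with w
    simp only [add_apply, smul_apply, Circle.smul_def, smul_eq_mul]
    ring
  exact_mod_cast key

lemma convex_testGraph (T : LevyTriplet n) : Convex ℝ T.testGraph := by
  rintro ⟨u, f⟩ ⟨hu, hcu, huf⟩ ⟨v, g⟩ ⟨hv, hcv, hvg⟩ a b - - -
  have h1 : ContDiff ℝ ∞ fun z => a * u z + b * v z :=
    (contDiff_const.mul hu).add (contDiff_const.mul hv)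
  have h2 : HasCompactSupport fun z => a * u z + b * v z :=
    (hcu.mul_left (f := fun _ => a)).add (hcv.mul_left (f := fun _ => b))
  refine ⟨h1, h2, fun x => ?_⟩
  refine Eq.trans ?_ (T.apply_linear hu hv hcu hcv a b h1 h2 x).symm
  rw [← huf, ← hvg]
  rfl

lemma integral_mem_closure {α F : Type*} [MeasurableSpace α] [NormedAddCommGroup F]
    [NormedSpace ℝ F] [CompleteSpace F] (ρ : Measure α) [IsProbabilityMeasure ρ] {s : Set (F × F)}
    (hs : Convex ℝ s) {G : α → F × F} (hG : ∀ y, G y ∈ s) (hi : Integrable G ρ) :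
    ∫ y, G y ∂ρ ∈ closure s :=
  hs.closure.integral_mem isClosed_closure (.of_forall fun y => subset_closure (hG y)) hi

lemma integral_translateC₀_pair (ρ : Measure (E n)) [IsProbabilityMeasure ρ] (u f : C₀(E n, ℝ)) :
    ∫ y, (translateC₀ y u, translateC₀ y f) ∂ρ = (average ρ u, average ρ f) := by
  rw [integral_pair (integrable_translateC₀ ρ u) (integrable_translateC₀ ρ f)]
  rfl

/-- The average is a barycentre of translated pairs, all of which lie in the convex set `testGraph`;
barycentres lie in its closure. -/
lemma average_mem_graph (ρ : Measure (E n)) [IsProbabilityMeasure ρ] {u f : C₀(E n, ℝ)}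
    (h : (u, f) ∈ T.testGraph) : (average ρ u, average ρ f) ∈ T.graph := by
  rw [← integral_translateC₀_pair]
  exact integral_mem_closure ρ (convex_testGraph T) (translateC₀_mem_testGraph h)
    ((integrable_translateC₀ ρ u).prodMk (integrable_translateC₀ ρ f))

end TestGraph

/-! ### Potential measures and the resolvent. -/

section Resolvent

variable {T : LevyTriplet n}

/-- `ρ` is the `r`-potential measure of the triplet, normalised to be a probability measure:
its characteristic function is `r / (r + ψ)`. -/
def IsPotential (T : LevyTriplet n) (r : ℝ) (ρ : Measure (E n)) : Prop :=
  ∀ ξ, charFun ρ ξ * (r + T.exponent ξ) = r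

variable {r : ℝ} {ρ : Measure (E n)} [IsProbabilityMeasure ρ]

/-- On the Fourier side `r u - A u` carries the factor `r + ψ`, averaging contributes the
characteristic function of `ρ`, and the product is `r`. -/
lemma average_of_mem_testGraph (hρ : IsPotential T r ρ) {u f : C₀(E n, ℝ)}
    (h : (u, f) ∈ T.testGraph) : average ρ (r • u - f) = r • u := by
  obtain ⟨hu, hc, hf⟩ := h
  set h := 𝓕 (complexTest hu hc) with hh
  have hi : Integrable (fun w => (r + T.exponent ((2 * Real.pi) • w)) * h w) := by
    simp only [add_mul]
    exact (h.integrable.const_mul _).add (integrable_exponent_mul T h)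
  have hi0 : ∀ x, Integrable (fun w => Real.fourierChar ⟪w, x⟫ • (r * h w)) := fun x =>
    integrable_fourierChar_smul_iff.2 (h.integrable.const_mul _)
  have hi1 : ∀ x, Integrable (fun w => Real.fourierChar ⟪w, x⟫ •
      (-T.exponent ((2 * Real.pi) • w) * h w)) := fun x => by
    refine integrable_fourierChar_smul_iff.2 ?_
    simp only [neg_mul]
    exact (integrable_exponent_mul T h).neg
  have hr : ∀ x, ((r * u x : ℝ) : ℂ) = ∫ w, Real.fourierChar ⟪w, x⟫ • (r * h w) := fun x => by
    rw [Complex.ofReal_mul, eq_fourierInv hu hc, ← integral_const_mul]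
    congr 1 with w
    simp only [Circle.smul_def, smul_eq_mul]
    ring
  have hg : ∀ x, ((r * u x - f x : ℝ) : ℂ) =
      ∫ w, Real.fourierChar ⟪w, x⟫ • ((r + T.exponent ((2 * Real.pi) • w)) * h w) := fun x => by
    rw [Complex.ofReal_sub, hr, hf, T.apply_eq_fourierInv hu hc, ← hh,
      ← integral_sub (hi0 x) (hi1 x)]
    congr 1 with w
    rw [← smul_sub]
    congr 1
    ring
  ext x
  rw [average_apply]
  change ∫ y, (r * u (x + y) - f (x + y)) ∂ρ = r * u x
  have key : ((∫ y, (r * u (x + y) - f (x + y)) ∂ρ : ℝ) : ℂ) = ((r * u x : ℝ) : ℂ) := by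
    rw [← integral_complex_ofReal]
    simp_rw [hg]
    rw [integral_integral_swap, hr]
    · congr 1 with w
      have hw : ∫ y, ((Real.fourierChar ⟪w, y⟫ : Circle) : ℂ) ∂ρ =
          charFun ρ ((2 * Real.pi) • w) := by
        rw [charFun_apply]
        congr 1 with y
        rw [fourierChar_eq_exp, inner_smul_right, real_inner_comm, mul_comm]
      simp_rw [inner_add_right, AddChar.map_add_eq_mul, Circle.smul_def, Circle.coe_mul,
        smul_eq_mul]
      rw [integral_mul_const, integral_const_mul, hw]
      linear_combination (((Real.fourierChar ⟪w, x⟫ : Circle) : ℂ) * h w) *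
        hρ ((2 * Real.pi) • w)
    · have hp : Integrable (fun p : E n × E n =>
          (r + T.exponent ((2 * Real.pi) • p.2)) * h p.2) (ρ.prod volume) :=
        hi.comp_snd ρ
      refine hp.norm.mono' ?_ (.of_forall fun p => ?_)
      · have hm : Measurable fun p : E n × E n =>
            ((Real.fourierChar ⟪p.2, x + p.1⟫ : Circle) : ℂ) := by
          simp_rw [fourierChar_eq_exp]
          fun_prop
        exact hm.aestronglyMeasurable.mul hp.aestronglyMeasurable
      · simp [Function.uncurry]
  exact_mod_cast key

/-- Averaging against the potential measure inverts `1 - A / r`. -/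
theorem average_of_mem_graph (hρ : IsPotential T r ρ) {u f : C₀(E n, ℝ)}
    (h : (u, f) ∈ T.graph) : average ρ (r • u - f) = r • u := by
  have hcl : IsClosed {p : C₀(E n, ℝ) × C₀(E n, ℝ) | averageCLM ρ (r • p.1 - p.2) = r • p.1} :=
    isClosed_eq (by fun_prop) (by fun_prop)
  exact closure_minimal (fun p hp => average_of_mem_testGraph hρ hp) hcl h

/-- The range of the resolvent is contained in the domain. -/
theorem average_mem_graph_of_isPotential (hρ : IsPotential T r ρ) (g : C₀(E n, ℝ)) :
    (average ρ g, r • average ρ g - r • g) ∈ T.graph := by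
  have hcl : IsClosed {g : C₀(E n, ℝ) |
      (averageCLM ρ g, r • averageCLM ρ g - r • g) ∈ T.graph} :=
    isClosed_closure.preimage (f := fun g => (averageCLM ρ g, r • averageCLM ρ g - r • g))
      (by fun_prop)
  suffices hs : {v : C₀(E n, ℝ) | ContDiff ℝ ∞ v ∧ HasCompactSupport v} ⊆
      {g : C₀(E n, ℝ) | (averageCLM ρ g, r • averageCLM ρ g - r • g) ∈ T.graph} by
    refine closure_minimal hs hcl (Metric.mem_closure_iff.2 fun ε hε => ?_)
    obtain ⟨v, hv, hvc, hvg⟩ := exists_test_near g (half_pos hε)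
    refine ⟨v, ⟨hv, hvc⟩, ?_⟩
    rw [dist_comm, dist_eq_norm]
    linarith
  rintro v ⟨hv, hvc⟩
  obtain ⟨f, hf⟩ := T.exists_apply_eq hv hvc
  have hm : (v, f) ∈ T.testGraph := ⟨hv, hvc, hf⟩
  have h1 := average_of_mem_testGraph hρ hm
  -- For a test function the resolvent identity, solved for the average of `A v`, is the required
  -- second component.
  have h2 : average ρ f = r • average ρ v - r • v := by
    rw [← averageCLM_apply, map_sub, map_smul] at h1
    rw [← h1]
    simp
  simpa [h2] using average_mem_graph ρ hm

/-- The Lévy operator is single-valued, provided that all potential measures exist. -/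
theorem eq_zero_of_zero_mem_graph
    (hT : ∀ r > 0, ∃ ρ : Measure (E n), IsProbabilityMeasure ρ ∧ IsPotential T r ρ)
    {f : C₀(E n, ℝ)} (h : (0, f) ∈ T.graph) : f = 0 := by
  -- Dissipativity argument: `(0, f)` in the graph forces the average of `f` to vanish, so `r (v -
  -- f) - A v` averages to `r v`. Contractivity, division by `r` and `r → ∞` give the bound; then
  -- `v` is taken close to `f`.
  have key : ∀ v : C₀(E n, ℝ), ContDiff ℝ ∞ v → HasCompactSupport v → ‖v‖ ≤ ‖v - f‖ := by
    intro v hv hvc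
    obtain ⟨g, hg⟩ := T.exists_apply_eq hv hvc
    have hr : ∀ r : ℝ, 0 < r → ‖v‖ ≤ ‖v - f‖ + ‖g‖ * r⁻¹ := by
      intro r hr
      obtain ⟨ρ, _, hρ⟩ := hT r hr
      have h1 := average_of_mem_graph hρ h
      have h2 := average_of_mem_testGraph hρ (show (v, g) ∈ T.testGraph from ⟨hv, hvc, hg⟩)
      have h3 : averageCLM ρ (r • (v - f) - g) = r • v := by
        rw [← averageCLM_apply] at h1 h2
        simp only [map_sub, map_smul, smul_zero, zero_sub, map_neg,
          neg_eq_zero] at h1 h2 ⊢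
        simpa [h1] using h2
      have h4 : r * ‖v‖ ≤ r * ‖v - f‖ + ‖g‖ := by
        calc r * ‖v‖ = ‖average ρ (r • (v - f) - g)‖ := by
              rw [← averageCLM_apply, h3, norm_smul, Real.norm_of_nonneg hr.le]
          _ ≤ ‖r • (v - f) - g‖ := norm_average_le ρ _
          _ ≤ ‖r • (v - f)‖ + ‖g‖ := norm_sub_le _ _
          _ = _ := by rw [norm_smul, Real.norm_of_nonneg hr.le]
      have h5 : r * ‖v‖ ≤ r * (‖v - f‖ + ‖g‖ * r⁻¹) := by
        rw [mul_add]
        have : r * (‖g‖ * r⁻¹) = ‖g‖ := by field_simp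
        rwa [this]
      exact le_of_mul_le_mul_left h5 hr
    have hl : Tendsto (fun r : ℝ => ‖v - f‖ + ‖g‖ * r⁻¹) atTop (𝓝 (‖v - f‖ + ‖g‖ * 0)) :=
      (tendsto_inv_atTop_zero.const_mul _).const_add _
    rw [mul_zero, add_zero] at hl
    exact ge_of_tendsto hl ((eventually_gt_atTop 0).mono hr)
  rw [← norm_le_zero_iff]
  refine le_of_forall_pos_le_add fun ε hε => ?_
  obtain ⟨v, hv, hvc, hvf⟩ := exists_test_near f (half_pos hε)
  have h1 := key v hv hvc
  have h2 := norm_sub_norm_le f v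
  rw [norm_sub_rev] at h2
  linarith

/-- Averaging against a potential measure is injective, provided that all potential measures
exist. -/
theorem average_injective
    (hT : ∀ r > 0, ∃ ρ : Measure (E n), IsProbabilityMeasure ρ ∧ IsPotential T r ρ)
    (hr : r ≠ 0) (hρ : IsPotential T r ρ) {g : C₀(E n, ℝ)} (hg : average ρ g = 0) : g = 0 := by
  have h := average_mem_graph_of_isPotential hρ g
  rw [hg, smul_zero, zero_sub] at h
  exact (smul_eq_zero.1 (neg_eq_zero.1 (eq_zero_of_zero_mem_graph hT h))).resolve_left hr

end Resolvent

end LevyUCP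

namespace LevyUCP

open scoped RealInnerProductSpace

variable {n : ℕ}

/-! ### Sampling the process at an independent exponential time. -/

section Discretization

/-- The smallest multiple of `1 / (k + 1)` that is larger than `t`. -/
noncomputable def gridAbove (k : ℕ) (t : ℝ≥0) : ℝ≥0 := (⌊(k + 1) * t⌋₊ + 1) / (k + 1)

lemma le_gridAbove (k : ℕ) (t : ℝ≥0) : t ≤ gridAbove k t := by
  rw [gridAbove, le_div_iff₀ (by positivity), mul_comm]
  exact (Nat.lt_floor_add_one _).le

lemma gridAbove_le (k : ℕ) (t : ℝ≥0) : gridAbove k t ≤ t + 1 / (k + 1) := by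
  have h : t + 1 / ((k : ℝ≥0) + 1) = ((k + 1) * t + 1) / (k + 1) := by field_simp
  rw [gridAbove, h]
  gcongr
  exact Nat.floor_le (by positivity)

lemma tendsto_gridAbove (t : ℝ≥0) : Tendsto (fun k => gridAbove k t) atTop (𝓝 t) := by
  have h : Tendsto (fun k : ℕ => t + 1 / ((k : ℝ≥0) + 1)) atTop (𝓝 (t + 0)) :=
    (tendsto_one_div_add_atTop_nhds_zero_nat (𝕜 := ℝ≥0)).const_add t
  rw [add_zero] at h
  exact tendsto_of_tendsto_of_tendsto_of_le_of_le tendsto_const_nhds h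
    (fun k => le_gridAbove k t) (fun k => gridAbove_le k t)

lemma measurable_gridAbove (k : ℕ) : Measurable (gridAbove k) := by
  unfold gridAbove
  fun_prop

/-- Evaluation of a path at the discretized time is jointly measurable. -/
lemma measurable_eval_gridAbove (k : ℕ) :
    Measurable fun p : ℝ≥0 × (ℝ≥0 → E n) => p.2 (gridAbove k p.1) := by
  -- Evaluation is not jointly measurable on the full path space; on a countable grid it is.
  have h1 : Measurable fun q : ℕ × (ℝ≥0 → E n) => q.2 ((q.1 + 1) / (k + 1)) :=
    measurable_from_prod_countable_right fun m =>
      measurable_pi_apply (((m : ℝ≥0) + 1) / (k + 1))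
  have h2 : Measurable fun p : ℝ≥0 × (ℝ≥0 → E n) => (⌊(k + 1) * p.1⌋₊, p.2) := by fun_prop
  exact h1.comp h2

end Discretization

section Exponential

lemma integral_exp_neg_mul_expMeasure {r : ℝ} (hr : 0 < r) {z : ℂ} (hz : 0 ≤ z.re) :
    (∫ t, Complex.exp (-(t * z)) ∂(expMeasure r)) * (r + z) = r := by
  have h0 : (r + z : ℂ) ≠ 0 := fun h => by
    have := congrArg Complex.re h
    simp at this
    linarith
  have hre : (-(r + z) : ℂ).re < 0 := by simp; linarith
  have h1 : ∫ t, Complex.exp (-(t * z)) ∂(expMeasure r) =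
      ∫ t in Set.Ici (0 : ℝ), r * Complex.exp (-(r + z) * t) := by
    rw [expMeasure, gammaMeasure, integral_withDensity_eq_integral_toReal_smul
      (show Measurable (gammaPDF 1 r) from (measurable_gammaPDFReal 1 r).ennreal_ofReal) (.of_forall fun t => ENNReal.ofReal_lt_top (r := gammaPDFReal 1 r t)),
      ← integral_indicator measurableSet_Ici]
    congr 1 with t
    have ht := exponentialPDF_eq r t
    rw [show gammaPDF 1 r t = exponentialPDF r t from rfl, ht]
    by_cases h : 0 ≤ t
    · rw [if_pos h, ENNReal.toReal_ofReal (by positivity), Set.indicator_of_mem (Set.mem_Ici.2 h),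
        Complex.real_smul]
      push_cast
      rw [mul_assoc, ← Complex.exp_add]
      ring_nf
    · rw [if_neg h, Set.indicator_of_notMem (by simpa using h)]
      simp
  rw [h1, integral_Ici_eq_integral_Ioi, integral_const_mul, integral_exp_mul_complex_Ioi hre]
  simp only [Complex.ofReal_zero, mul_zero, Complex.exp_zero, neg_div_neg_eq]
  field_simp

lemma expMeasure_ae_nonneg (r : ℝ) : ∀ᵐ t ∂(expMeasure r), 0 ≤ t := by
  rw [ae_iff]
  have hs : {t : ℝ | ¬ 0 ≤ t} = Set.Iio 0 := by ext t; simp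
  rw [hs, expMeasure, gammaMeasure, withDensity_apply _ measurableSet_Iio]
  exact lintegral_gammaPDF_of_nonpos le_rfl

end Exponential

section RandomTime

variable {T : LevyTriplet n} {Ω : Type*} [MeasurableSpace Ω] {P : Measure Ω}
  {X : ℝ≥0 → Ω → E n}

/-- The characteristic function at time `1` has modulus `e^{-Re ψ}`, which is at most `1`. -/
lemma LevyTriplet.IsAssociated.exponent_re_nonneg [IsProbabilityMeasure P]
    (hX : T.IsAssociated X P) (ξ : E n) :
    0 ≤ (T.exponent ξ).re := by
  have hp : IsProbabilityMeasure (P.map (X 1)) :=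
    Measure.isProbabilityMeasure_map (hX.isLevy.measurable 1).aemeasurable
  have h := norm_charFun_le_one (μ := P.map (X 1)) ξ
  rw [hX.charFun_eq, Complex.norm_exp] at h
  simpa using h

variable {Ω' : Type*} [MeasurableSpace Ω'] {P' : Measure Ω'}
  {π : Ω' → Ω} {τ : Ω' → ℝ≥0}

lemma measurable_path (hX : IsLevy X P) (hπ : Measurable π) :
    Measurable fun ω t => X t (π ω) :=
  measurable_pi_lambda _ fun t => (hX.measurable t).comp hπ

/-- The grid times approach `τ` from above, so right-continuity suffices. -/
lemma ae_tendsto_gridAbove (hX : IsLevy X P) (hπ : MeasurePreserving π P' P) :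
    ∀ᵐ ω ∂P', Tendsto (fun k => X (gridAbove k (τ ω)) (π ω)) atTop (𝓝 (X (τ ω) (π ω))) := by
  filter_upwards [hπ.quasiMeasurePreserving.ae hX.right_continuous] with ω hω
  exact (hω (τ ω)).tendsto.comp (tendsto_nhdsWithin_of_tendsto_nhds_of_eventually_within _
    (tendsto_gridAbove _) (.of_forall fun k => le_gridAbove k _))

lemma measurable_gridAbove_time (hX : IsLevy X P) (hπ : Measurable π) (hτ : Measurable τ)
    (k : ℕ) : Measurable fun ω => X (gridAbove k (τ ω)) (π ω) :=
  (measurable_eval_gridAbove k).comp (hτ.prodMk (measurable_path hX hπ))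

lemma aemeasurable_at_time (hX : IsLevy X P) (hπ : MeasurePreserving π P' P)
    (hτ : Measurable τ) : AEMeasurable (fun ω => X (τ ω) (π ω)) P' :=
  aemeasurable_of_tendsto_metrizable_ae atTop
    (fun k => (measurable_gridAbove_time hX hπ.measurable hτ k).aemeasurable)
    (ae_tendsto_gridAbove hX hπ)

variable [IsProbabilityMeasure P']

lemma isProbabilityMeasure_at_time (hX : IsLevy X P) (hπ : MeasurePreserving π P' P)
    (hτ : Measurable τ) : IsProbabilityMeasure (P'.map fun ω => X (τ ω) (π ω)) :=
  Measure.isProbabilityMeasure_map (aemeasurable_at_time hX hπ hτ)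

/-- Independence turns the joint law of time and path into a product; integrating over paths first
leaves `e^{-tψ}` at the grid time. -/
lemma integral_gridAbove (hX : T.IsAssociated X P) (hπ : MeasurePreserving π P' P)
    (hτ : Measurable τ) (hi : IndepFun τ (fun ω t => X t (π ω)) P') (k : ℕ) (ξ : E n) :
    ∫ ω, Complex.exp ((⟪X (gridAbove k (τ ω)) (π ω), ξ⟫ : ℝ) * Complex.I) ∂P' =
      ∫ ω, Complex.exp (-((gridAbove k (τ ω) : ℝ) * T.exponent ξ)) ∂P' := by
  have hY := measurable_path hX.isLevy hπ.measurable
  have hm : Measurable fun p : ℝ≥0 × (ℝ≥0 → E n) =>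
      Complex.exp ((⟪p.2 (gridAbove k p.1), ξ⟫ : ℝ) * Complex.I) := by
    have := measurable_eval_gridAbove (n := n) k
    fun_prop
  have h1 := (indepFun_iff_map_prod_eq_prod_map_map hτ.aemeasurable hY.aemeasurable).1 hi
  have hp1 : IsProbabilityMeasure (P'.map τ) := Measure.isProbabilityMeasure_map hτ.aemeasurable
  have hp2 : IsProbabilityMeasure (P'.map fun ω t => X t (π ω)) :=
    Measure.isProbabilityMeasure_map hY.aemeasurable
  have h2 := integral_map (μ := P') (hτ.prodMk hY).aemeasurable hm.aestronglyMeasurable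
  rw [h1, integral_prod] at h2
  · refine h2.symm.trans ?_
    rw [← integral_map (f := fun t : ℝ≥0 => Complex.exp (-((gridAbove k t : ℝ) * T.exponent ξ)))
      hτ.aemeasurable]
    · congr 1 with t
      rw [← hX.charFun_eq, charFun_apply, integral_map hY.aemeasurable,
        integral_map (hX.isLevy.measurable _).aemeasurable, ← hπ.map_eq,
        integral_map hπ.measurable.aemeasurable]
      · have := hX.isLevy.measurable (gridAbove k t)
        exact Measurable.aestronglyMeasurable (by fun_prop)
      · exact Measurable.aestronglyMeasurable (by fun_prop)
      · exact (hm.comp (measurable_prodMk_left (x := t))).aestronglyMeasurable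
    · have := measurable_gridAbove k
      exact Measurable.aestronglyMeasurable (by fun_prop)
  · refine .of_bound hm.aestronglyMeasurable 1 (.of_forall fun p => ?_)
    rw [Complex.norm_exp_ofReal_mul_I]

/-- The law of a Lévy process at an independent exponential time is a potential measure. -/
theorem isPotential_at_time [IsProbabilityMeasure P] (hX : T.IsAssociated X P) (hπ : MeasurePreserving π P' P)
    (hτ : Measurable τ) {r : ℝ} (hr : 0 < r) (hl : P'.map (fun ω => (τ ω : ℝ)) = expMeasure r)
    (hi : IndepFun τ (fun ω t => X t (π ω)) P') :
    IsPotential T r (P'.map fun ω => X (τ ω) (π ω)) := by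
  intro ξ
  have hz := hX.exponent_re_nonneg ξ
  have h1 : Tendsto (fun k => ∫ ω, Complex.exp ((⟪X (gridAbove k (τ ω)) (π ω), ξ⟫ : ℝ) *
      Complex.I) ∂P') atTop
      (𝓝 (∫ ω, Complex.exp ((⟪X (τ ω) (π ω), ξ⟫ : ℝ) * Complex.I) ∂P')) := by
    refine tendsto_integral_of_dominated_convergence (fun _ => 1) (fun k => ?_)
      (integrable_const _) (fun k => .of_forall fun ω => ?_) ?_
    · exact Measurable.aestronglyMeasurable (((measurable_gridAbove_time hX.isLevy hπ.measurable
        hτ k).inner_const.complex_ofReal.mul_const _).cexp)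
    · rw [Complex.norm_exp_ofReal_mul_I]
    · filter_upwards [ae_tendsto_gridAbove (τ := τ) hX.isLevy hπ] with ω hω
      have hc : Continuous fun x : E n => Complex.exp ((⟪x, ξ⟫ : ℝ) * Complex.I) := by fun_prop
      exact (hc.tendsto _).comp hω
  have h2 : Tendsto (fun k => ∫ ω, Complex.exp (-((gridAbove k (τ ω) : ℝ) * T.exponent ξ)) ∂P')
      atTop (𝓝 (∫ ω, Complex.exp (-((τ ω : ℝ) * T.exponent ξ)) ∂P')) := by
    refine tendsto_integral_of_dominated_convergence (fun _ => 1) (fun k => ?_)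
      (integrable_const _) (fun k => .of_forall fun ω => ?_) (.of_forall fun ω => ?_)
    · have := measurable_gridAbove k
      exact Measurable.aestronglyMeasurable (by fun_prop)
    · rw [Complex.norm_exp]
      have : 0 ≤ (gridAbove k (τ ω) : ℝ) * (T.exponent ξ).re := mul_nonneg NNReal.zero_le_coe hz
      simpa using this
    · have hc : Continuous fun t : ℝ≥0 => Complex.exp (-((t : ℝ) * T.exponent ξ)) := by fun_prop
      exact (hc.tendsto _).comp (tendsto_gridAbove (τ ω))
  simp_rw [integral_gridAbove hX hπ hτ hi] at h1
  -- The limit is the Laplace transform of the exponential law at `ψ`, that is `r / (r + ψ)`.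
  have h3 := integral_exp_neg_mul_expMeasure hr hz
  rw [← hl, integral_map (by fun_prop) (Measurable.aestronglyMeasurable (by fun_prop))] at h3
  rwa [charFun_apply, integral_map (aemeasurable_at_time hX.isLevy hπ hτ)
    (Measurable.aestronglyMeasurable (by fun_prop)), tendsto_nhds_unique h1 h2]

end RandomTime

/-- An independent exponential time exists on the product extension. -/
lemma exists_exponential_time {Ω : Type u} [MeasurableSpace Ω] (P : Measure Ω)
    [IsProbabilityMeasure P] {X : ℝ≥0 → Ω → E n} (hX : IsLevy X P) {r : ℝ} (hr : 0 < r) :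
    ∃ (Ω' : Type u) (_ : MeasurableSpace Ω') (P' : Measure Ω') (_ : IsProbabilityMeasure P')
      (π : Ω' → Ω) (τ : Ω' → ℝ≥0), MeasurePreserving π P' P ∧ Measurable τ ∧
      P'.map (fun ω => (τ ω : ℝ)) = expMeasure r ∧ IndepFun τ (fun ω t => X t (π ω)) P' := by
  have := isProbabilityMeasure_expMeasure hr
  have hq : IsProbabilityMeasure ((expMeasure r).map Real.toNNReal) :=
    Measure.isProbabilityMeasure_map (by fun_prop)
  refine ⟨Ω × ℝ≥0, inferInstance, P.prod ((expMeasure r).map Real.toNNReal), inferInstance,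
    Prod.fst, Prod.snd, measurePreserving_fst, measurable_snd, ?_, ?_⟩
  · have h1 : (P.prod ((expMeasure r).map Real.toNNReal)).map (fun ω => (ω.2 : ℝ)) =
        ((P.prod ((expMeasure r).map Real.toNNReal)).map Prod.snd).map ((↑) : ℝ≥0 → ℝ) := by
      rw [Measure.map_map (by fun_prop) (by fun_prop)]
      rfl
    rw [h1, measurePreserving_snd.map_eq, Measure.map_map (by fun_prop) (by fun_prop)]
    conv_rhs => rw [← Measure.map_id (μ := expMeasure r)]
    refine Measure.map_congr ?_
    filter_upwards [expMeasure_ae_nonneg r] with t ht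
    simp [ht]
  · exact (indepFun_prod (X := fun ω t => X t ω) (Y := fun t : ℝ≥0 => t)
      (measurable_pi_lambda _ hX.measurable) measurable_id).symm

end LevyUCP

namespace LevyUCP

/-! ### Vague density and annihilators. -/

section Duality

variable {Y : Type*} [TopologicalSpace Y] [MeasurableSpace Y] [BorelSpace Y]

lemma integrable_signedMeasure (m : SignedMeasure Y) (φ : C₀(Y, ℝ)) : m.Integrable φ := by
  have : IsFiniteMeasure m.variation := by
    rw [← SignedMeasure.totalVariation_eq_variation]
    infer_instance
  exact integrable_zeroAtInfty φ m.variation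

/-- The duality pairing `(φ, m) ↦ ∫ φ dm`. -/
noncomputable def pairing : C₀(Y, ℝ) →ₗ[ℝ] SignedMeasure Y →ₗ[ℝ] ℝ :=
  LinearMap.mk₂ ℝ (fun φ m => m.integral φ (ContinuousLinearMap.lsmul ℝ ℝ))
    (fun φ ψ m => VectorMeasure.integral_add (integrable_signedMeasure m φ)
      (integrable_signedMeasure m ψ))
    (fun c φ m => VectorMeasure.integral_fun_smul m _ c φ)
    (fun φ m m' => VectorMeasure.integral_add_vectorMeasure (integrable_signedMeasure m φ)
      (integrable_signedMeasure m' φ))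
    (fun c φ _ => VectorMeasure.integral_smul_vectorMeasure φ c)

lemma pairing_apply (φ : C₀(Y, ℝ)) (m : SignedMeasure Y) :
    pairing φ m = m.integral φ (ContinuousLinearMap.lsmul ℝ ℝ) := rfl

lemma pairing_toSignedMeasure (φ : C₀(Y, ℝ)) (μ : Measure Y) [IsFiniteMeasure μ] :
    pairing φ μ.toSignedMeasure = ∫ y, φ y ∂μ := by
  have h : (ContinuousLinearMap.lsmul ℝ ℝ : ℝ →L[ℝ] ℝ →L[ℝ] ℝ) =
      (ContinuousLinearMap.lsmul ℝ ℝ).flip := by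
    ext; simp
  rw [pairing_apply, h, VectorMeasure.integral_toSignedMeasure]

lemma eq_zero_of_pairing_eq_zero {φ : C₀(Y, ℝ)} (h : ∀ m, pairing φ m = 0) : φ = 0 := by
  ext y
  have := h (Measure.dirac y).toSignedMeasure
  rwa [pairing_toSignedMeasure, integral_dirac' _ _ (map_continuous φ).stronglyMeasurable] at this

lemma vagueTopology_eq_induced : vagueTopology Y =
    TopologicalSpace.induced (fun (m : SignedMeasure Y) (φ : C₀(Y, ℝ)) => pairing φ m)
      Pi.topologicalSpace := by
  simp only [vagueTopology, Pi.topologicalSpace, induced_iInf, induced_compose]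
  rfl

/-- If only `0` annihilates the subspace `S`, then finitely many functionals cannot separate a
signed measure from `S`. -/
lemma exists_mem_forall_pairing_eq {S : Submodule ℝ (SignedMeasure Y)}
    (hS : ∀ φ : C₀(Y, ℝ), (∀ m ∈ S, pairing φ m = 0) → φ = 0) (I : Finset C₀(Y, ℝ))
    (m : SignedMeasure Y) : ∃ s ∈ S, ∀ φ ∈ I, pairing φ s = pairing φ m := by
  classical
  let L : SignedMeasure Y →ₗ[ℝ] (I → ℝ) := LinearMap.pi fun φ => pairing (φ : C₀(Y, ℝ))
  by_cases hm : L m ∈ S.map L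
  · obtain ⟨s, hs, hsm⟩ := hm
    exact ⟨s, hs, fun φ hφ => congrFun hsm ⟨φ, hφ⟩⟩
  · exfalso
    -- A functional on the finite-dimensional space `I → ℝ` separating `L m` from the image of `S`
    -- pulls back to pairing with a linear combination of `I`. That combination annihilates `S`,
    -- hence is `0`: a contradiction.
    obtain ⟨c, hc, hker⟩ := Submodule.exists_le_ker_of_notMem hm
    have hcL : ∀ m', c (L m') = pairing (∑ φ : I, c (Pi.single φ 1) • (φ : C₀(Y, ℝ))) m' := by
      intro m'
      rw [LinearMap.pi_apply_eq_sum_univ c (L m'), map_sum, LinearMap.sum_apply]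
      refine Finset.sum_congr rfl fun φ _ => ?_
      have h1 : (fun j => if φ = j then (1 : ℝ) else 0) = Pi.single φ 1 := by
        ext j
        simp [Pi.single_apply, eq_comm]
      rw [map_smul, LinearMap.smul_apply, smul_eq_mul, smul_eq_mul, mul_comm, h1]
      rfl
    have h0 := hS _ fun m' hm' => (hcL m').symm.trans (hker (Submodule.mem_map_of_mem hm'))
    refine hc ?_
    rw [hcL, h0, map_zero, LinearMap.zero_apply]

/-- A subspace of the finite signed measures is vaguely dense if, and only if, its annihilator in
`C₀` is trivial. -/
theorem vaguelyDense_iff (S : Submodule ℝ (SignedMeasure Y)) :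
    VaguelyDense (S : Set (SignedMeasure Y)) ↔
      ∀ φ : C₀(Y, ℝ), (∀ m ∈ S, pairing φ m = 0) → φ = 0 := by
  let _ : TopologicalSpace (SignedMeasure Y) := vagueTopology Y
  have hind : IsInducing fun (m : SignedMeasure Y) (φ : C₀(Y, ℝ)) => pairing φ m :=
    ⟨vagueTopology_eq_induced⟩
  change Dense (S : Set (SignedMeasure Y)) ↔ _
  constructor
  · intro hd φ hφ
    have hcont : Continuous fun m : SignedMeasure Y => pairing φ m :=
      (continuous_apply φ).comp hind.continuous
    refine eq_zero_of_pairing_eq_zero fun m => ?_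
    have := (isClosed_eq hcont continuous_const).closure_subset_iff.2
      (show (S : Set (SignedMeasure Y)) ⊆ {m | pairing φ m = 0} from hφ)
    exact this (hd m)
  · intro hS m
    rw [hind.closure_eq_preimage_closure_image, Set.mem_preimage, mem_closure_iff]
    intro U hU hmU
    obtain ⟨I, v, hv, hvU⟩ := isOpen_pi_iff.1 hU _ hmU
    obtain ⟨s, hs, hsm⟩ := exists_mem_forall_pairing_eq hS I m
    refine ⟨_, hvU fun φ hφ => ?_, s, hs, rfl⟩
    change pairing φ s ∈ v φ
    rw [hsm φ hφ]
    exact (hv φ hφ).2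

theorem vaguelyDense_span_iff (S : Set (SignedMeasure Y)) :
    VaguelyDense (Submodule.span ℝ S : Set (SignedMeasure Y)) ↔
      ∀ φ : C₀(Y, ℝ), (∀ m ∈ S, pairing φ m = 0) → φ = 0 := by
  rw [vaguelyDense_iff]
  refine forall_congr' fun φ => imp_congr_left ?_
  have : Submodule.span ℝ S ≤ LinearMap.ker (pairing φ) ↔ S ⊆ LinearMap.ker (pairing φ) :=
    Submodule.span_le
  exact this

end Duality

/-! ### Transfer between the exterior domain and the whole space. -/

section Exterior

variable {n : ℕ} {ε : ℝ}

lemma isOpenEmbedding_exterior : IsOpenEmbedding (Subtype.val : Exterior n ε → E n) :=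
  Metric.isClosed_closedBall.isOpen_compl.isOpenEmbedding_subtypeVal

/-- Compactness of the sets `{δ ≤ |g|}` encodes decay both at infinity and at the boundary of the
exterior, and moves along the inclusion in either direction. -/
lemma isCompact_setOf_le_abs {Z : Type*} [TopologicalSpace Z] (g : C₀(Z, ℝ)) {δ : ℝ}
    (hδ : 0 < δ) : IsCompact {x | δ ≤ |g x|} := by
  obtain ⟨K, hK, hKs⟩ := mem_cocompact.1 (Metric.tendsto_nhds.1 g.zero_at_infty' δ hδ)
  refine hK.of_isClosed_subset (isClosed_le continuous_const g.continuous.abs) fun x hx => ?_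
  by_contra hxK
  have : dist (g x) 0 < δ := hKs hxK
  rw [dist_zero_right, Real.norm_eq_abs] at this
  exact absurd hx (not_le.2 this)

lemma zero_at_infty_of_isCompact {Z : Type*} [TopologicalSpace Z] {g : Z → ℝ}
    (h : ∀ δ > 0, IsCompact {x | δ ≤ |g x|}) : Tendsto g (cocompact Z) (𝓝 0) := by
  refine Metric.tendsto_nhds.2 fun δ hδ => mem_cocompact.2 ⟨_, h δ hδ, fun x hx => ?_⟩
  simpa using hx

/-- The restriction to the exterior domain of a function of class `C₀` vanishing on the ball. -/
noncomputable def restrictExterior (g : C₀(E n, ℝ))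
    (hg : ∀ x ∈ Metric.closedBall (0 : E n) ε, g x = 0) : C₀(Exterior n ε, ℝ) where
  toFun x := g x
  continuous_toFun := g.continuous.comp continuous_subtype_val
  zero_at_infty' := zero_at_infty_of_isCompact fun δ hδ => by
    refine isOpenEmbedding_exterior.isInducing.isCompact_preimage' (isCompact_setOf_le_abs g hδ)
      fun x hx => ?_
    rw [Subtype.range_coe]
    intro hxb
    have hx' : δ ≤ |g x| := hx
    rw [hg x hxb, abs_zero] at hx'
    linarith

@[simp] lemma restrictExterior_apply (g : C₀(E n, ℝ))
    (hg : ∀ x ∈ Metric.closedBall (0 : E n) ε, g x = 0) (x : Exterior n ε) :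
    restrictExterior g hg x = g x := rfl

open Classical in
/-- Every function of class `C₀` on the exterior domain extends by zero. -/
lemma exists_extension (φ : C₀(Exterior n ε, ℝ)) : ∃ g : C₀(E n, ℝ),
    (∀ x : Exterior n ε, g x = φ x) ∧ ∀ x ∈ Metric.closedBall (0 : E n) ε, g x = 0 := by
  let g : E n → ℝ := fun x => if h : x ∈ (Metric.closedBall (0 : E n) ε)ᶜ then φ ⟨x, h⟩ else 0
  have hg1 : ∀ x : Exterior n ε, g x = φ x := fun x => by simp only [g, dif_pos x.2]
  have hg0 : ∀ x ∈ Metric.closedBall (0 : E n) ε, g x = 0 := fun x hx => by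
    simp only [g]
    rw [dif_neg (by simpa using hx)]
  have hK : ∀ δ > 0, IsCompact {x | δ ≤ |g x|} := fun δ hδ => by
    convert! (isCompact_setOf_le_abs φ hδ).image continuous_subtype_val
    ext x
    simp only [Set.mem_ofPred_eq, Set.mem_image]
    constructor
    · intro hx
      by_cases hxb : x ∈ Metric.closedBall (0 : E n) ε
      · rw [hg0 x hxb, abs_zero] at hx
        linarith
      · exact ⟨⟨x, hxb⟩, by rwa [← hg1], rfl⟩
    · rintro ⟨y, hy, rfl⟩
      rwa [hg1]
  refine ⟨⟨⟨g, continuous_iff_continuousAt.2 fun x => ?_⟩, zero_at_infty_of_isCompact hK⟩,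
    hg1, hg0⟩
  by_cases hx : x ∈ Metric.closedBall (0 : E n) ε
  -- The set `{δ ≤ |g|}` is compact, hence closed, and misses `x`; this covers boundary points of
  -- the ball.
  · rw [ContinuousAt, hg0 x hx]
    refine Metric.tendsto_nhds.2 fun δ hδ => ?_
    have : {x | δ ≤ |g x|}ᶜ ∈ 𝓝 x := (hK δ hδ).isClosed.isOpen_compl.mem_nhds (by
      simp [hg0 x hx, hδ])
    filter_upwards [this] with y hy
    simpa using hy
  · rw [← show ((⟨x, hx⟩ : Exterior n ε) : E n) = x from rfl,
      ← isOpenEmbedding_exterior.continuousAt_iff]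
    have : g ∘ Subtype.val = φ := funext hg1
    rw [this]
    exact φ.continuous.continuousAt

/-- The measure `ρ(· + x)` is the image of `ρ` under `y ↦ y - x`, whence the sign; it is harmless
because the ball is symmetric. -/
lemma pairing_shiftRestrict (ρ : Measure (E n)) [IsProbabilityMeasure ρ]
    {φ : C₀(Exterior n ε, ℝ)} {g : C₀(E n, ℝ)} (hφ : ∀ x : Exterior n ε, g x = φ x)
    (hg : ∀ x ∈ Metric.closedBall (0 : E n) ε, g x = 0) (x : E n) :
    pairing φ (shiftRestrict ρ ε x) = average ρ g (-x) := by
  rw [shiftRestrict, pairing_toSignedMeasure, average_apply]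
  simp_rw [← hφ]
  rw [integral_subtype_comap Metric.isClosed_closedBall.measurableSet.compl g,
    setIntegral_eq_integral_of_forall_compl_eq_zero (fun y hy => hg y (by simpa using hy)),
    integral_map (by fun_prop) (map_continuous g).aestronglyMeasurable]
  simp only [sub_eq_neg_add]

end Exterior

end LevyUCP

/-! ### The equivalence. -/

open LevyUCP in
/-- The independent exponential time `τ` lives on an arbitrary extension `π : Ω' → Ω` of the
probability space that carries the Lévy process `X`, since `Ω` itself need not carry one. -/
theorem corollary3p2 {n : ℕ} (T : LevyTriplet n)
    {Ω : Type u} [MeasurableSpace Ω] (P : Measure Ω) [IsProbabilityMeasure P]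
    (X : ℝ≥0 → Ω → E n) (hX : T.IsAssociated X P) :
    T.UCP ↔
      ∀ (Ω' : Type u) [MeasurableSpace Ω'] (P' : Measure Ω') [IsProbabilityMeasure P']
        (π : Ω' → Ω) (_ : MeasurePreserving π P' P)
        (τ : Ω' → ℝ≥0) (_ : Measurable τ)
        (r : ℝ) (_ : 0 < r) (_ : P'.map (fun ω => (τ ω : ℝ)) = expMeasure r)
        (_ : IndepFun τ (fun ω t => X t (π ω)) P')
        (ε : ℝ) (_ : 0 < ε),
        VaguelyDense (Submodule.span ℝ (shiftFamily (P'.map (fun ω => X (τ ω) (π ω))) ε) :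
          Set (SignedMeasure (Exterior n ε))) := by
  constructor
  · intro hU Ω' _ P' _ π hπ τ hτ r hr hl hi ε hε
    have hprob := isProbabilityMeasure_at_time hX.isLevy hπ hτ
    have hρ := isPotential_at_time hX hπ hτ hr hl hi
    have hT : ∀ r > 0, ∃ ρ : Measure (E n), IsProbabilityMeasure ρ ∧ IsPotential T r ρ := by
      intro r hr
      obtain ⟨Ω₁, _, P₁, _, π₁, τ₁, hπ₁, hτ₁, hl₁, hi₁⟩ :=
        exists_exponential_time P hX.isLevy hr
      exact ⟨_, isProbabilityMeasure_at_time hX.isLevy hπ₁ hτ₁,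
        isPotential_at_time hX hπ₁ hτ₁ hr hl₁ hi₁⟩
    refine (vaguelyDense_span_iff _).2 fun φ hφ => ?_
    obtain ⟨g, hgφ, hg0⟩ := exists_extension φ
    have havg : ∀ x ∈ Metric.ball (0 : E n) ε, average (P'.map fun ω => X (τ ω) (π ω)) g x = 0 := by
      intro x hx
      have h := hφ _ ⟨-x, by simpa using hx, rfl⟩
      rwa [pairing_shiftRestrict _ hgφ hg0, neg_neg] at h
    -- UCP is applied to `u = R g`: both `R g` and `A u = r (R g - g)` vanish on the ball.
    have h0 := hU _ _ (average_mem_graph_of_isPotential hρ g) ⟨Metric.ball 0 ε, Metric.isOpen_ball,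
      Metric.nonempty_ball.2 hε, fun x hx => ?_, havg⟩
    · have hg := average_injective hT hr.ne' hρ h0
      ext x
      rw [← hgφ, hg]
      rfl
    · change r * average _ g x - r * g x = 0
      rw [havg x hx, hg0 x (Metric.ball_subset_closedBall hx)]
      ring
  · rintro hD u f huf ⟨G, hGo, ⟨x₀, hx₀⟩, hf, hu⟩
    obtain ⟨Ω', _, P', _, π, τ, hπ, hτ, hl, hi⟩ :=
      exists_exponential_time P hX.isLevy (r := 1) one_pos
    have hprob := isProbabilityMeasure_at_time hX.isLevy hπ hτ
    have hρ := isPotential_at_time hX hπ hτ one_pos hl hi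
    obtain ⟨ε, hε, hεG⟩ := Metric.nhds_basis_closedBall.mem_iff.1 (hGo.mem_nhds hx₀)
    have hmem : ∀ x ∈ Metric.closedBall (0 : E n) ε, x + x₀ ∈ G := fun x hx =>
      hεG (by simpa using hx)
    have havg := average_of_mem_graph hρ huf
    set ρ := P'.map fun ω => X (τ ω) (π ω)
    have hg0 : ∀ x ∈ Metric.closedBall (0 : E n) ε,
        translateC₀ x₀ ((1 : ℝ) • u - f) x = 0 := fun x hx => by
      change 1 * u (x + x₀) - f (x + x₀) = 0
      rw [hu _ (hmem x hx), hf _ (hmem x hx)]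
      ring
    -- With the single rate `r = 1`, the translate of `u - A u` to the origin annihilates the shift
    -- family, since its averages are values of `u` in `G`.
    have hφ := (vaguelyDense_span_iff _).1 (hD Ω' P' π hπ τ hτ 1 one_pos hl hi ε hε)
      (restrictExterior _ hg0) (by
        rintro _ ⟨x, hx, rfl⟩
        rw [pairing_shiftRestrict ρ (fun _ => rfl) hg0, average_apply]
        simp_rw [translateC₀_apply, add_right_comm _ _ x₀]
        rw [← average_apply, havg]
        change 1 * u (-x + x₀) = 0
        rw [hu _ (hmem _ (Metric.ball_subset_closedBall (by simpa using hx))), mul_zero])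
    have hz : (1 : ℝ) • u - f = 0 := by
      ext x
      by_cases hx : x - x₀ ∈ Metric.closedBall (0 : E n) ε
      · simpa using hg0 _ hx
      · have := congrArg (fun ψ : C₀(Exterior n ε, ℝ) => ψ ⟨x - x₀, hx⟩) hφ
        simpa using this
    rw [hz, ← averageCLM_apply, map_zero, one_smul] at havg
    exact havg.symm
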